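/- **Definitions.** A *semi-coarse space* is a set $X$ with a family $\mathcal V$ of subsets of $X\times X$ (the *controlled sets*) that contains the diagonal and is closed under subsets, finite unions and inverses. A map $f$ is *bornologous* if $f\times f$ sends controlled sets to controlled sets. A subset $Y\subset X$ carries the structure $\{V\cap (Y\times Y): V\in\mathcal V\}$. For $V\subset X\times X$ and $W\subset Y\times Y$ put $V\boxtimes W=\{((x,y),(x',y')):(x,x')\in V,\ (y,y')\in W\}$; the controlled sets of the product $X\times Y$ are the subsets of finite unions of sets $V\boxtimes W$ with $V,W$ controlled, and similarly for finitely many factors. The integers $\mathbb Z$ carry the structure whose controlled sets are the subsets of $\{(a,b):|a-b|\le 1\}$. For sets $B\subset A\subset X$ and $D\subset C\subset Y$, a *map of triples* $f:(X,A,B)\to(Y,C,D)$ is a bornologous map $f:X\to Y$ with $f(A)\subset C$ and $f(B)\subset D$. Two such maps $f,g$ are *homotopic* if there are a bornologous map $H:X\times\mathbb Z\to Y$ with $H(A\times\mathbb Z)\subset C$, $H(B\times \mathbb Z)\subset D$, and integers $M<N$ such that $H(x,t)=f(x)$ for $t\le M$ and $H(x,t)=g(x)$ for $t\ge N$. This is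 an equivalence relation. For $m\ge 0$ and $n\ge 1$ let $I_m=\{0,\dots,m\}\subset\mathbb Z$ and let $I_m^n$ be the $n$-fold product. Let $\partial I_m^n$ be the set of points with some coordinate in $\{0,m\}$, and let $J_m^{n-1}$ be the set of $x\in\partial I_m^n$ such that, if $x_n=0$, then $x_i\in\{0,m\}$ for some $i\ne n$ (for $n=1$, $m=0$ put $J_0^{0}=I_0$). For $m\le k$ let $\phi_m^k:I_k^n\to I_m^n$ replace each coordinate $x_i$ by $\min(x_i,m)$. Let $*\in A\subset X$. Then $f\mapsto f\circ\phi_m^k$ induces maps from the homotopy classes of maps of triples $(I_m^n,\partial I_m^n,J_m^{n-1})\to (X,A,\{*\})$ to those of maps $(I_k^n,\partial I_k^n,J_k^{n-1})\to (X,A,\{*\})$, which form a direct system indexed by $m\in\mathbb N$. Its direct limit is $\pi_n^{sc}(X,A,*)$, and $\langle f\rangle$ denotes the class of $f$ in it. Put $\pi_n^{sc}(X,*)=\pi_n^{sc}(X,\{*\},*)$. For $f:I_m^n\to X$ and $g:I_k^n\to X$ define $f\star g:I_{m+k}^n\to X$ by $$(f\star g)(\alpha)=\begin{cases} f(\phi_m^{m+k}(\alpha))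 & \text{if } 0\le\alpha_1\le m,\\ g(\phi_k^{m+k}(\alpha-me_1)) & \text{if } m<\alpha_1\le m+k,\end{cases}\qquad e_1=(1,0,\dots,0).$$ **Theorem (Semi-coarse homotopy groups).** Let $X$ be a semi-coarse space, $*\in A\subset X$ and $n\ge 1$. If $n\geq 2$, then for all maps of triples $f:(I_m^n,\partial I_m^n,J_m^{n-1})\to (X,A,\{*\})$ and $g:(I_k^n,\partial I_k^n,J_k^{n-1})\to (X,A,\{*\})$ the map $f\star g$ is again a map of triples, and $\langle f\rangle\star\langle g\rangle=\langle f\star g\rangle$ gives a well-defined operation on $\pi_n^{sc}(X,A,*)$; for $A=\{*\}$ the same holds for all $n\ge 1$. With these operations: * $\pi_n^{sc}(X,*)$ is a group for $n\ge 1$; * $\pi_n^{sc}(X,*)$ is an abelian group for $n\ge 2$; * $\pi_n^{sc}(X,A,*)$ is a group for $n\ge 2$; * $\pi_n^{sc}(X,A,*)$ is an abelian group for $n\ge 3$. -/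

import Mathlib

/-- A semi-coarse structure on `X`: a family of subsets of `X × X` (the controlled sets) that
contains the diagonal and is closed under subsets, binary unions and inverses. -/
class SemiCoarseSpace (X : Type*) where
  controlled : Set (Set (X × X))
  diagonal_mem : Set.diagonal X ∈ controlled
  subset_mem : ∀ {A B : Set (X × X)}, B ∈ controlled → A ⊆ B → A ∈ controlled
  union_mem : ∀ {A B : Set (X × X)}, A ∈ controlled → B ∈ controlled → A ∪ B ∈ controlled
  inverse_mem : ∀ {A : Set (X × X)}, A ∈ controlled → {p | (p.2, p.1) ∈ A} ∈ controlled

namespace SemiCoarse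

open SemiCoarseSpace

/-- A map is bornologous if it sends controlled sets to controlled sets. -/
def Bornologous {X Y : Type*} [SemiCoarseSpace X] [SemiCoarseSpace Y] (f : X → Y) : Prop :=
  ∀ V ∈ controlled (X := X), Prod.map f f '' V ∈ controlled (X := Y)

theorem Bornologous.comp {X Y Z : Type*} [SemiCoarseSpace X] [SemiCoarseSpace Y]
    [SemiCoarseSpace Z] {g : Y → Z} {f : X → Y} (hg : Bornologous g) (hf : Bornologous f) :
    Bornologous (g ∘ f) := by
  intro V hV
  have h := hg _ (hf V hV)
  rwa [← Set.image_comp, Prod.map_comp_map] at h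

/-- The subspace structure: the controlled sets are the traces of the ambient ones. -/
instance subspace {X : Type*} [SemiCoarseSpace X] (Y : Set X) : SemiCoarseSpace Y where
  controlled :=
    {U | ∃ V ∈ controlled (X := X), U = Prod.map (Subtype.val) (Subtype.val) ⁻¹' V}
  diagonal_mem := ⟨Set.diagonal X, diagonal_mem, by
    ext ⟨a, b⟩; simp [Subtype.ext_iff]⟩
  subset_mem := by
    rintro A B ⟨V, hV, rfl⟩ hAB
    refine ⟨Prod.map Subtype.val Subtype.val '' A, subset_mem hV ?_, ?_⟩
    · rintro _ ⟨p, hp, rfl⟩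
      exact hAB hp
    · exact (Set.preimage_image_eq A
        (Subtype.val_injective.prodMap Subtype.val_injective)).symm
  union_mem := by
    rintro A B ⟨V, hV, rfl⟩ ⟨W, hW, rfl⟩
    exact ⟨V ∪ W, union_mem hV hW, rfl⟩
  inverse_mem := by
    rintro A ⟨V, hV, rfl⟩
    exact ⟨_, inverse_mem hV, rfl⟩

/-- The Cartesian cross product `V ⊠ W` of two relations. -/
def cross {X Y : Type*} (V : Set (X × X)) (W : Set (Y × Y)) : Set ((X × Y) × (X × Y)) :=
  {p | (p.1.1, p.2.1) ∈ V ∧ (p.1.2, p.2.2) ∈ W}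

/-- The product structure: the subsets of finite unions of sets `V ⊠ W` with `V` and `W`
controlled. -/
instance product {X Y : Type*} [SemiCoarseSpace X] [SemiCoarseSpace Y] :
    SemiCoarseSpace (X × Y) where
  controlled := {U | ∃ S : Set (Set (X × X) × Set (Y × Y)), S.Finite ∧
    (∀ P ∈ S, P.1 ∈ controlled (X := X) ∧ P.2 ∈ controlled (X := Y)) ∧
    U ⊆ ⋃ P ∈ S, cross P.1 P.2}
  diagonal_mem := by
    refine ⟨{(Set.diagonal X, Set.diagonal Y)}, Set.finite_singleton _, ?_, ?_⟩
    · rintro P rfl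
      exact ⟨diagonal_mem, diagonal_mem⟩
    · rintro ⟨p, q⟩ h
      obtain rfl : p = q := h
      simp [cross]
  subset_mem := by
    rintro A B ⟨S, hS, hc, hB⟩ hAB
    exact ⟨S, hS, hc, hAB.trans hB⟩
  union_mem := by
    rintro A B ⟨S, hS, hSc, hA⟩ ⟨T, hT, hTc, hB⟩
    refine ⟨S ∪ T, hS.union hT, ?_, ?_⟩
    · rintro P (hP | hP)
      exacts [hSc P hP, hTc P hP]
    · rw [Set.biUnion_union]
      exact Set.union_subset_union hA hB
  inverse_mem := by
    rintro A ⟨S, hS, hc, hA⟩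
    refine ⟨(fun P => ({p | (p.2, p.1) ∈ P.1}, {p | (p.2, p.1) ∈ P.2})) '' S, hS.image _, ?_, ?_⟩
    · rintro _ ⟨P, hP, rfl⟩
      exact ⟨inverse_mem (hc P hP).1, inverse_mem (hc P hP).2⟩
    · intro p hp
      obtain ⟨P, hP, h⟩ := Set.mem_iUnion₂.1 (hA hp)
      exact Set.mem_iUnion₂.2 ⟨_, ⟨P, hP, rfl⟩, h⟩

/-- A controlled set of a product lies in a single `V ⊠ W`. -/
theorem product_controlled_iff {X Y : Type*} [SemiCoarseSpace X] [SemiCoarseSpace Y]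
    {U : Set ((X × Y) × (X × Y))} :
    U ∈ controlled (X := X × Y) ↔
      ∃ V ∈ controlled (X := X), ∃ W ∈ controlled (X := Y), U ⊆ cross V W := by
  constructor
  · rintro ⟨S, hS, hc, hU⟩
    suffices h : ∃ V ∈ controlled (X := X), ∃ W ∈ controlled (X := Y),
        ⋃ P ∈ S, cross P.1 P.2 ⊆ cross V W by
      obtain ⟨V, hV, W, hW, h⟩ := h
      exact ⟨V, hV, W, hW, hU.trans h⟩
    clear hU
    induction S, hS using Set.Finite.induction_on with
    | empty => exact ⟨_, diagonal_mem, _, diagonal_mem, by simp⟩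
    | @insert P S _ _ ih =>
      obtain ⟨V, hV, W, hW, h⟩ := ih fun Q hQ => hc Q (Set.mem_insert_of_mem _ hQ)
      have hP := hc P (Set.mem_insert _ _)
      refine ⟨P.1 ∪ V, union_mem hP.1 hV, P.2 ∪ W, union_mem hP.2 hW, ?_⟩
      rw [Set.biUnion_insert]
      refine Set.union_subset (fun p hp => ⟨Or.inl hp.1, Or.inl hp.2⟩) fun p hp => ?_
      exact ⟨Or.inr (h hp).1, Or.inr (h hp).2⟩
  · rintro ⟨V, hV, W, hW, h⟩
    refine ⟨{(V, W)}, Set.finite_singleton _, ?_, by simpa using h⟩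
    rintro P rfl
    exact ⟨hV, hW⟩

/-- The product of a family of semi-coarse spaces (used only for finite families): the controlled
sets are the subsets of the boxes with controlled sides. For finitely many factors this is the
iterated binary product, since a finite union of boxes lies in one box. -/
instance piProduct {ι : Type*} {X : ι → Type*} [∀ i, SemiCoarseSpace (X i)] :
    SemiCoarseSpace (∀ i, X i) where
  controlled := {U | ∃ V : ∀ i, Set (X i × X i), (∀ i, V i ∈ controlled) ∧
    U ⊆ {p | ∀ i, (p.1 i, p.2 i) ∈ V i}}
  diagonal_mem := by
    refine ⟨fun i => Set.diagonal (X i), fun i => diagonal_mem, ?_⟩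
    rintro ⟨p, q⟩ h i
    obtain rfl : p = q := h
    rfl
  subset_mem := by
    rintro A B ⟨V, hV, hB⟩ hAB
    exact ⟨V, hV, hAB.trans hB⟩
  union_mem := by
    rintro A B ⟨V, hV, hA⟩ ⟨W, hW, hB⟩
    refine ⟨fun i => V i ∪ W i, fun i => union_mem (hV i) (hW i), ?_⟩
    rintro p (hp | hp) i
    exacts [Or.inl (hA hp i), Or.inr (hB hp i)]
  inverse_mem := by
    rintro A ⟨V, hV, hA⟩
    exact ⟨fun i => {p | (p.2, p.1) ∈ V i}, fun i => inverse_mem (hV i), fun p hp i => hA hp i⟩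

/-- The canonical (nearest neighbour) structure on `ℤ`: the controlled sets are the sets of pairs
of integers at distance at most one. -/
instance integers : SemiCoarseSpace ℤ where
  controlled := 𝒫 {p : ℤ × ℤ | |p.1 - p.2| ≤ 1}
  diagonal_mem := by
    rintro ⟨p, q⟩ h
    obtain rfl : p = q := h
    simp
  subset_mem := fun hB hAB => hAB.trans hB
  union_mem := fun hA hB => Set.union_subset hA hB
  inverse_mem := by
    intro A hA p hp
    have h : |p.2 - p.1| ≤ 1 := hA hp
    rwa [abs_sub_comm] at h

/-! ### Maps of triples and their homotopies -/

/-- Bornologous maps of triples `(X, A, B) → (Y, C, D)`. -/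
structure TripleMap {X Y : Type*} [SemiCoarseSpace X] [SemiCoarseSpace Y]
    (A B : Set X) (C D : Set Y) where
  toFun : X → Y
  bornologous : Bornologous toFun
  map_fst : Set.MapsTo toFun A C
  map_snd : Set.MapsTo toFun B D

/-- Homotopy of maps of triples, parametrised by `ℤ` and stationary near `±∞`. -/
def TripleMap.Homotopic {X Y : Type*} [SemiCoarseSpace X] [SemiCoarseSpace Y]
    {A B : Set X} {C D : Set Y} (f g : TripleMap A B C D) : Prop :=
  ∃ H : X × ℤ → Y, Bornologous H ∧
    (∃ M N : ℤ, M < N ∧ (∀ x, ∀ t ≤ M, H (x, t) = f.toFun x) ∧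
      (∀ x, ∀ t ≥ N, H (x, t) = g.toFun x)) ∧
    (∀ x ∈ A, ∀ t, H (x, t) ∈ C) ∧ (∀ x ∈ B, ∀ t, H (x, t) ∈ D)

theorem bornologous_fst {X Y : Type*} [SemiCoarseSpace X] [SemiCoarseSpace Y] :
    Bornologous (Prod.fst : X × Y → X) := by
  intro U hU
  obtain ⟨V, hV, W, -, h⟩ := product_controlled_iff.1 hU
  refine subset_mem hV ?_
  rintro _ ⟨p, hp, rfl⟩
  exact (h hp).1

theorem Bornologous.prodMap {X Y X' Y' : Type*} [SemiCoarseSpace X] [SemiCoarseSpace Y]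
    [SemiCoarseSpace X'] [SemiCoarseSpace Y'] {f : X → X'} {g : Y → Y'} (hf : Bornologous f)
    (hg : Bornologous g) : Bornologous (Prod.map f g) := by
  intro U hU
  obtain ⟨V, hV, W, hW, h⟩ := product_controlled_iff.1 hU
  refine product_controlled_iff.2 ⟨_, hf V hV, _, hg W hW, ?_⟩
  rintro _ ⟨p, hp, rfl⟩
  exact ⟨⟨_, (h hp).1, rfl⟩, ⟨_, (h hp).2, rfl⟩⟩

theorem bornologous_id {X : Type*} [SemiCoarseSpace X] : Bornologous (id : X → X) := by
  intro V hV
  simpa using hV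

theorem bornologous_int {f : ℤ → ℤ} (hf : ∀ s t, |s - t| ≤ 1 → |f s - f t| ≤ 1) :
    Bornologous f := by
  rintro V hV _ ⟨p, hp, rfl⟩
  exact hf _ _ (hV hp)

theorem TripleMap.homotopic_equivalence {X Y : Type*} [SemiCoarseSpace X] [SemiCoarseSpace Y]
    {A B : Set X} {C D : Set Y} : Equivalence (Homotopic (A := A) (B := B) (C := C) (D := D)) where
  refl f := ⟨f.toFun ∘ Prod.fst, f.bornologous.comp bornologous_fst,
    ⟨0, 1, one_pos, fun _ _ _ => rfl, fun _ _ _ => rfl⟩,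
    fun _ hx _ => f.map_fst hx, fun _ hx _ => f.map_snd hx⟩
  symm := by
    rintro f g ⟨H, hH, ⟨M, N, hMN, h₁, h₂⟩, hA, hB⟩
    refine ⟨H ∘ Prod.map id (fun t => -t), hH.comp (bornologous_id.prodMap (bornologous_int ?_)),
      ⟨-N, -M, neg_lt_neg hMN, fun x t ht => h₂ x _ (by linarith),
        fun x t ht => h₁ x _ (by linarith)⟩, fun x hx t => hA x hx _, fun x hx t => hB x hx _⟩
    intro s t h
    rw [abs_le] at *
    constructor <;> linarith
  trans := by
    rintro f g h ⟨H, hH, ⟨M, N, hMN, hf, hg⟩, hA, hB⟩ ⟨H', hH', ⟨M', N', hMN', hg', hh⟩, hA', hB'⟩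
    have hs : Bornologous (H' ∘ Prod.map id (fun t => t - N + M')) :=
      hH'.comp (bornologous_id.prodMap (bornologous_int fun s t h => by
        rwa [show s - N + M' - (t - N + M') = s - t by ring]))
    let K : X × ℤ → Y := fun p => if p.2 ≤ N then H p else H' (p.1, p.2 - N + M')
    have hK₁ : ∀ x, ∀ t ≤ N, K (x, t) = H (x, t) := fun x t ht => if_pos ht
    have hK₂ : ∀ x, ∀ t ≥ N, K (x, t) = H' (x, t - N + M') := by
      intro x t ht
      rcases ht.lt_or_eq with ht | rfl
      · exact if_neg ht.not_ge
      · rw [hK₁ x _ le_rfl, hg x _ le_rfl, hg' x _ (by linarith)]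
    refine ⟨K, ?_, ⟨M, N + (N' - M'), by linarith, ?_, ?_⟩, ?_, ?_⟩
    · intro V hV
      refine subset_mem (union_mem (hH V hV) (hs V hV)) ?_
      rintro _ ⟨⟨⟨x, s⟩, ⟨y, t⟩⟩, hp, rfl⟩
      have hst : |s - t| ≤ 1 := by
        obtain ⟨V', -, W, hW, h⟩ := product_controlled_iff.1 hV
        exact hW (h hp).2
      rw [abs_le] at hst
      by_cases hc : s ≤ N ∧ t ≤ N
      · refine Or.inl ⟨_, hp, ?_⟩
        simp [hK₁ x s hc.1, hK₁ y t hc.2]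
      · refine Or.inr ⟨_, hp, ?_⟩
        have h₁ : N ≤ s := by by_contra!; exact hc ⟨by omega, by omega⟩
        have h₂ : N ≤ t := by by_contra!; exact hc ⟨by omega, by omega⟩
        simp [hK₂ x s h₁, hK₂ y t h₂]
    · intro x t ht
      rw [hK₁ x t (by linarith), hf x t ht]
    · intro x t ht
      rw [hK₂ x t (by linarith), hh x _ (by linarith)]
    · intro x hx t
      rcases le_total t N with ht | ht
      · exact hK₁ x t ht ▸ hA x hx t
      · exact hK₂ x t ht ▸ hA' x hx _
    · intro x hx t
      rcases le_total t N with ht | ht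
      · exact hK₁ x t ht ▸ hB x hx t
      · exact hK₂ x t ht ▸ hB' x hx _

instance homotopySetoid {X Y : Type*} [SemiCoarseSpace X] [SemiCoarseSpace Y]
    (A B : Set X) (C D : Set Y) : Setoid (TripleMap A B C D) :=
  ⟨TripleMap.Homotopic, TripleMap.homotopic_equivalence⟩

/-- The set of homotopy classes `[(X, A, B), (Y, C, D)]`. -/
def HomotopyClasses {X Y : Type*} [SemiCoarseSpace X] [SemiCoarseSpace Y]
    (A B : Set X) (C D : Set Y) : Type _ :=
  Quotient (homotopySetoid A B C D)

/-! ### Discrete cubes -/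

/-- The interval `I_m = {0, …, m}`, a subspace of `ℤ`. -/
abbrev Interval (m : ℕ) : Type := (Set.Icc (0 : ℤ) m : Set ℤ)

/-- The cube `I_m ^ n` with the product structure. -/
abbrev Cube (n m : ℕ) : Type := Fin n → Interval m

/-- `∂ I_m ^ n`: some coordinate is `0` or `m`. -/
def boundary (n m : ℕ) : Set (Cube n m) :=
  {x | ∃ i, (x i : ℤ) = 0 ∨ (x i : ℤ) = m}

/-- The open box `J_m ^ (n - 1)`: the boundary points such that, if the last coordinate is `0`,
then some other coordinate is `0` or `m`. The condition is not imposed for `m = 0`; this makes a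
difference only for `n = 1`, where the one point of `I_0 = {0}` also has last coordinate `m` and so
belongs to the box. -/
def openBox (n m : ℕ) : Set (Cube n m) :=
  {x | x ∈ boundary n m ∧ ∀ l : Fin n, (l : ℕ) + 1 = n → 0 < m → (x l : ℤ) = 0 →
    ∃ i, i ≠ l ∧ ((x i : ℤ) = 0 ∨ (x i : ℤ) = m)}

/-- The map `φ : I_k ^ n → I_m ^ n` that replaces each coordinate exceeding `m` by `m`. -/
def retract {n k : ℕ} (m : ℕ) (x : Cube n k) : Cube n m :=
  fun i => ⟨min (x i : ℤ) m, le_min (x i).2.1 (Int.natCast_nonneg m), min_le_right _ _⟩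

theorem retract_bornologous {n k : ℕ} (m : ℕ) :
    Bornologous (retract m : Cube n k → Cube n m) := by
  rintro U ⟨V, hV, hU⟩
  refine ⟨fun i => Prod.map Subtype.val Subtype.val ⁻¹' {p : ℤ × ℤ | |p.1 - p.2| ≤ 1},
    fun i => ⟨_, fun _ h => h, rfl⟩, ?_⟩
  rintro _ ⟨⟨x, y⟩, hp, rfl⟩ i
  obtain ⟨W, hW, h⟩ := hV i
  have h₁ := hU hp i
  rw [h] at h₁
  have h₂ : |(x i : ℤ) - y i| ≤ 1 := hW h₁
  change |min (x i : ℤ) m - min (y i : ℤ) m| ≤ 1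
  rw [abs_le] at *
  omega

theorem retract_boundary {n m k : ℕ} (h : m ≤ k) :
    Set.MapsTo (retract m) (boundary n k) (boundary n m) := by
  rintro x ⟨i, hi⟩
  refine ⟨i, ?_⟩
  change min (x i : ℤ) m = 0 ∨ min (x i : ℤ) m = m
  omega

theorem retract_openBox {n m k : ℕ} (h : m ≤ k) :
    Set.MapsTo (retract m) (openBox n k) (openBox n m) := by
  rintro x ⟨hx, hb⟩
  refine ⟨retract_boundary h hx, fun l hl hm h₀ => ?_⟩
  change min (x l : ℤ) m = 0 at h₀
  obtain ⟨i, hne, hi⟩ := hb l hl (by omega) (by omega)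
  refine ⟨i, hne, ?_⟩
  change min (x i : ℤ) m = 0 ∨ min (x i : ℤ) m = m
  omega

theorem retract_self {n m : ℕ} (x : Cube n m) : retract m x = x := by
  funext i
  exact Subtype.ext (min_eq_left (x i).2.2)

theorem retract_retract {n m k l : ℕ} (h : m ≤ k) (x : Cube n l) :
    retract m (retract k x) = retract m x := by
  funext i
  refine Subtype.ext ?_
  change min (min (x i : ℤ) k) m = min (x i : ℤ) m
  omega

/-! ### The homotopy sets -/

section HomotopySets

variable {X : Type*} [SemiCoarseSpace X]

/-- Bornologous maps `(I_m ^ n, ∂ I_m ^ n, J_m ^ (n - 1)) → (X, A, *)`. -/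
abbrev CubeMap (n : ℕ) (A : Set X) (pt : X) (m : ℕ) : Type _ :=
  TripleMap (boundary n m) (openBox n m) A {pt}

/-- The homotopy classes of maps `(I_m ^ n, ∂ I_m ^ n, J_m ^ (n - 1)) → (X, A, *)`. -/
abbrev CubeClasses (n : ℕ) (A : Set X) (pt : X) (m : ℕ) : Type _ :=
  HomotopyClasses (boundary n m) (openBox n m) A {pt}

/-- The extension `f ∘ φ` of `f` to a larger cube. -/
def CubeMap.extend {n : ℕ} {A : Set X} {pt : X} {m k : ℕ} (h : m ≤ k) (f : CubeMap n A pt m) :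
    CubeMap n A pt k where
  toFun := f.toFun ∘ retract m
  bornologous := f.bornologous.comp (retract_bornologous m)
  map_fst := f.map_fst.comp (retract_boundary h)
  map_snd := f.map_snd.comp (retract_openBox h)

theorem CubeMap.extend_homotopic {n : ℕ} {A : Set X} {pt : X} {m k : ℕ} (h : m ≤ k)
    {f g : CubeMap n A pt m} (hfg : f.Homotopic g) :
    (CubeMap.extend h f).Homotopic (CubeMap.extend h g) := by
  obtain ⟨H, hH, ⟨M, N, hMN, h₁, h₂⟩, hA, hB⟩ := hfg
  exact ⟨H ∘ Prod.map (retract m) id, hH.comp ((retract_bornologous m).prodMap bornologous_id),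
    ⟨M, N, hMN, fun x t ht => h₁ _ t ht, fun x t ht => h₂ _ t ht⟩,
    fun x hx t => hA _ (retract_boundary h hx) t, fun x hx t => hB _ (retract_openBox h hx) t⟩

/-- The transition map on homotopy classes induced by extension of maps. -/
def transition (n : ℕ) (A : Set X) (pt : X) (m k : ℕ) (h : m ≤ k) :
    CubeClasses n A pt m → CubeClasses n A pt k :=
  Quotient.map (CubeMap.extend h) fun _ _ => CubeMap.extend_homotopic h

/-- Functions are function-like; needed to apply `DirectLimit` to a system of plain functions. -/
@[reducible]
def functionFunLike (α β : Type*) : FunLike (α → β) α β :=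
  ⟨id, Function.injective_id⟩

attribute [local instance] functionFunLike

instance transition_directedSystem (n : ℕ) (A : Set X) (pt : X) :
    DirectedSystem (CubeClasses n A pt) (fun m k h => DFunLike.coe (transition n A pt m k h)) where
  map_self := by
    rintro m ⟨f⟩
    refine congrArg (Quotient.mk _) ?_
    cases f
    simp only [CubeMap.extend, TripleMap.mk.injEq]
    funext x
    simp [retract_self]
  map_map := by
    rintro l k m hmk hkl ⟨f⟩
    refine congrArg (Quotient.mk _) ?_
    simp only [CubeMap.extend, TripleMap.mk.injEq]
    funext x
    simp [retract_retract hmk]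

/-- The relative homotopy set `π_n^{sc}(X, A, *)`: the direct limit over `m` of the sets of
homotopy classes of maps `(I_m ^ n, ∂ I_m ^ n, J_m ^ (n - 1)) → (X, A, *)`. -/
def RelHomotopySet (n : ℕ) (A : Set X) (pt : X) : Type _ :=
  DirectLimit (CubeClasses n A pt) (transition n A pt)

/-- The absolute homotopy set `π_n^{sc}(X, *)`, which is `π_n^{sc}(X, {*}, *)`. -/
abbrev HomotopySet (n : ℕ) (pt : X) : Type _ :=
  RelHomotopySet n {pt} pt

/-- The class `⟨f⟩` of a cube map in the direct limit. -/
def cls {n : ℕ} {A : Set X} {pt : X} {m : ℕ} (f : CubeMap n A pt m) : RelHomotopySet n A pt :=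
  Quotient.mk (DirectLimit.setoid (transition n A pt)) ⟨m, Quotient.mk _ f⟩

/-- The first coordinate is lowered by `m`; the other coordinates are unchanged. -/
def shiftFirst {n m k : ℕ} [NeZero n] (x : Cube n (m + k)) (h : (m : ℤ) < x 0) : Cube n (m + k) :=
  fun i => ⟨if i = 0 then (x i : ℤ) - m else x i, by
    obtain ⟨h₀, h₁⟩ := (x i).2
    split_ifs with hi
    · subst hi
      constructor <;> omega
    · exact ⟨h₀, h₁⟩⟩

open Classical in
/-- The concatenation `f ⋆ g` of two maps along the first coordinate. -/
noncomputable def star {n m k : ℕ} [NeZero n] (f : Cube n m → X) (g : Cube n k → X) :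
    Cube n (m + k) → X :=
  fun x => if h : (m : ℤ) < x 0 then g (retract k (shiftFirst x h)) else f (retract m x)

/-- The operation `op` is given on classes by `⟨f⟩ ⋆ ⟨g⟩ = ⟨f ⋆ g⟩` for all representatives `f` and
`g`; in particular every such `f ⋆ g` is again a bornologous map of triples. As every class has a
representative, at most one operation has this property. -/
def IsStarOperation {n : ℕ} [NeZero n] {A : Set X} {pt : X}
    (op : RelHomotopySet n A pt → RelHomotopySet n A pt → RelHomotopySet n A pt) : Prop :=
  ∀ (m k : ℕ) (f : CubeMap n A pt m) (g : CubeMap n A pt k),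
    ∃ fg : CubeMap n A pt (m + k), fg.toFun = star f.toFun g.toFun ∧ op (cls f) (cls g) = cls fg

end HomotopySets

end SemiCoarse

/-! Clamping coordinates extends a cube map to a map on the grid `ℕ^n` that equals `pt` far out. The
direct limit over the cube size then becomes the set of such grid loops modulo the relation
generated by `Step` (`homotopySetEquiv`). The maps built from grid loops have finite range, so being
bornologous can be tested on single pairs (`bornologous_of_finite_range`).

Grid loops are concatenated at any seam `p` beyond which the first one is `pt`. Associativity and
the unit laws hold pointwise for well-chosen seams. The remaining homotopies come from
`class_eq_of_reparam`, which joins `F ∘ P` to `F ∘ Q` for nonexpansive `P ≤ Q`: it makes the class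
independent of the seam, and it contracts the product of a reflected loop with the loop.

The set `B` lists the zero faces allowed to land in `A`: none in the absolute case, the last one in
the relative case. Concatenation works along every coordinate outside `B`. One such coordinate gives
a group, and two give an abelian group by Eckmann–Hilton (`LoopClasses.mul_mul_mul_comm`), whence
the bounds on `n`. -/

namespace SemiCoarse

open SemiCoarseSpace

/-! ### Pointwise nearness -/

section Near

variable {X : Type*} [SemiCoarseSpace X]

/-- Two points are near if the pair they form is controlled. -/
def Near (a b : X) : Prop :=
  ({(a, b)} : Set (X × X)) ∈ controlled (X := X)

theorem Near.refl (a : X) : Near a a :=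
  subset_mem diagonal_mem (by rintro _ rfl; rfl)

theorem Near.symm {a b : X} (h : Near a b) : Near b a := by
  refine subset_mem (inverse_mem h) ?_
  rintro _ rfl
  rfl

theorem controlled_of_finite {U : Set (X × X)} (hU : U.Finite) (h : ∀ p ∈ U, Near p.1 p.2) :
    U ∈ controlled (X := X) := by
  induction U, hU using Set.Finite.induction_on with
  | empty => exact subset_mem diagonal_mem (Set.empty_subset _)
  | @insert p U _ _ ih =>
    rw [Set.insert_eq]
    exact union_mem (h p (Set.mem_insert _ _)) (ih fun q hq => h q (Set.mem_insert_of_mem _ hq))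

/-- The image of any controlled set lies in the finite set `range f ×ˢ range f`, hence is a finite
union of controlled singletons. -/
theorem bornologous_of_finite_range {Y : Type*} [SemiCoarseSpace Y] {f : Y → X}
    (hf : (Set.range f).Finite)
    (h : ∀ V ∈ controlled (X := Y), ∀ p ∈ V, Near (f p.1) (f p.2)) : Bornologous f := by
  intro V hV
  refine controlled_of_finite ((hf.prod hf).subset ?_) ?_
  · rintro _ ⟨p, -, rfl⟩
    exact ⟨⟨_, rfl⟩, ⟨_, rfl⟩⟩
  · rintro _ ⟨p, hp, rfl⟩
    exact h V hV p hp

theorem Bornologous.near {Y : Type*} [SemiCoarseSpace Y] {f : Y → X} (hf : Bornologous f)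
    {a b : Y} (h : Near a b) : Near (f a) (f b) := by
  have := hf _ h
  rwa [Set.image_singleton] at this

end Near

/-! ### Maps on the grid -/

section Concat

variable {ι : Type*}

/-- Grid points are adjacent if all their coordinates differ by at most one. -/
def Adj (x y : ι → ℕ) : Prop :=
  ∀ i, x i ≤ y i + 1 ∧ y i ≤ x i + 1

variable [DecidableEq ι]

theorem Adj.update {x y : ι → ℕ} (h : Adj x y) (i : ι) {a b : ℕ} (hab : a ≤ b + 1)
    (hba : b ≤ a + 1) : Adj (Function.update x i a) (Function.update y i b) := by
  intro j
  rcases eq_or_ne j i with rfl | hj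
  · simpa using ⟨hab, hba⟩
  · simpa [hj] using h j

variable {X : Type*} {pt : X}

/-- Concatenation of maps on the grid along the coordinate `i`, with the second map starting at
`x i = p`. -/
def concat (i : ι) (p : ℕ) (F G : (ι → ℕ) → X) : (ι → ℕ) → X :=
  fun x => if x i ≤ p then F x else G (Function.update x i (x i - p))

theorem concat_eq_of_le {i j : ι} {p q : ℕ} {F G : (ι → ℕ) → X} (hij : i ≠ j)
    (hF : ∀ x, q ≤ x j → F x = pt) (hG : ∀ x, q ≤ x j → G x = pt) (x : ι → ℕ) (hx : q ≤ x j) :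
    concat i p F G x = pt := by
  unfold concat
  split_ifs
  · exact hF x hx
  · exact hG _ (by simpa [hij.symm] using hx)

theorem concat_eq_of_add_le {i : ι} {p q : ℕ} {F G : (ι → ℕ) → X}
    (hF : ∀ x, p ≤ x i → F x = pt) (hG : ∀ x, q ≤ x i → G x = pt) (x : ι → ℕ)
    (hx : p + q ≤ x i) : concat i p F G x = pt := by
  unfold concat
  split_ifs
  · exact hF x (by omega)
  · exact hG _ (by simp; omega)

end Concat

/-! ### Loops on the grid -/

section Grid

variable {ι : Type*} {X : Type*} [SemiCoarseSpace X]

/-- Two maps on the grid are one homotopy step apart if they send adjacent points to near points.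
In particular `Step F F` means that `F` itself preserves nearness. -/
def Step (F G : (ι → ℕ) → X) : Prop :=
  ∀ x y, Adj x y → Near (F x) (G y)

/-- Maps on the grid that preserve nearness, take the value `pt` far out and on the faces `x i = 0`
for `i ∉ B`, and take values in `A` on the faces `x i = 0` for `i ∈ B`. -/
structure IsGridLoop (A : Set X) (pt : X) (B : Set ι) (F : (ι → ℕ) → X) : Prop where
  step : Step F F
  zero : ∀ x, ∀ i ∉ B, x i = 0 → F x = pt
  mem : ∀ x, ∀ i ∈ B, x i = 0 → F x ∈ A
  bdd : ∃ m : ℕ, ∀ x i, m ≤ x i → F x = pt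

/-- The type of grid loops. -/
abbrev GridLoop (A : Set X) (pt : X) (B : Set ι) : Type _ :=
  {F : (ι → ℕ) → X // IsGridLoop A pt B F}

/-- Grid loops up to homotopy. -/
def LoopClasses (A : Set X) (pt : X) (B : Set ι) : Type _ :=
  Quot fun F G : GridLoop A pt B => Step F.1 G.1

variable {A : Set X} {pt : X} {B : Set ι}

/-- The class of a grid loop. -/
def GridLoop.class (F : GridLoop A pt B) : LoopClasses A pt B :=
  Quot.mk _ F

theorem GridLoop.exists_bound (F : GridLoop A pt B) (i : ι) :
    ∃ p : ℕ, ∀ x : ι → ℕ, p ≤ x i → F.1 x = pt :=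
  F.2.bdd.imp fun _ h x => h x i

theorem GridLoop.class_congr {F G : GridLoop A pt B} (h : ∀ x, F.1 x = G.1 x) :
    F.class = G.class :=
  congrArg _ (Subtype.ext (funext h))

/-- Homotopy of reparametrisations: two nonexpansive reparametrisations `P ≤ Q` are joined by
`max P (min Q t)`. -/
theorem class_eq_of_reparam {F : (ι → ℕ) → X} {m M : ℕ} (hF : IsGridLoop A pt B F)
    (hm : ∀ x i, m ≤ x i → F x = pt) {P Q : (ι → ℕ) → ι → ℕ} (hPQ : ∀ x i, P x i ≤ Q x i)
    (hP : ∀ x y, Adj x y → Adj (P x) (P y)) (hQ : ∀ x y, Adj x y → Adj (Q x) (Q y))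
    (hbd : ∀ x i, (M ≤ x i ∨ (x i = 0 ∧ i ∉ B)) → m ≤ P x i ∨ (i ∉ B ∧ Q x i = 0))
    (hfree : ∀ x, ∀ i ∈ B, x i = 0 → Q x i = 0)
    {F₁ F₂ : GridLoop A pt B} (h₁ : ∀ x, F₁.1 x = F (P x)) (h₂ : ∀ x, F₂.1 x = F (Q x)) :
    F₁.class = F₂.class := by
  let R : ℕ → (ι → ℕ) → ι → ℕ := fun t x i => max (P x i) (min (Q x i) t)
  have hR : ∀ s t x y, s ≤ t + 1 → t ≤ s + 1 → Adj x y → Adj (R s x) (R t y) := by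
    intro s t x y hst hts h i
    have h₁ := hP x y h i
    have h₂ := hQ x y h i
    simp only [R]
    omega
  -- Every stage lies between `P` and `Q`. If `P x i` is already at least `m`, so is the stage; if
  -- `Q x i = 0`, the stage stays on that zero face.
  have hface : ∀ t x i, (M ≤ x i ∨ (x i = 0 ∧ i ∉ B)) → F (R t x) = pt := by
    intro t x i hi
    rcases hbd x i hi with h | ⟨hB, h⟩
    · exact hm _ i (h.trans (le_max_left _ _))
    · refine hF.zero _ i hB ?_
      have := hPQ x i
      simp only [R]
      omega
  have hL : ∀ t, IsGridLoop A pt B fun x => F (R t x) := fun t =>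
    { step := fun x y h => hF.step _ _ (hR t t x y (by omega) (by omega) h)
      zero := fun x i hi h => hface t x i (Or.inr ⟨h, hi⟩)
      mem := fun x i hi h => hF.mem _ i hi (by
        have := hPQ x i
        have := hfree x i hi h
        simp only [R]
        omega)
      bdd := ⟨M, fun x i h => hface t x i (Or.inl h)⟩ }
  have hchain : ∀ t, GridLoop.class ⟨_, hL 0⟩ = GridLoop.class ⟨_, hL t⟩ := by
    intro t
    induction t with
    | zero => rfl
    | succ t ih =>
      refine ih.trans (Quot.sound fun x y h => hF.step _ _ (hR _ _ x y ?_ ?_ h)) <;> omega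
  refine (GridLoop.class_congr fun x => ?_).trans
    ((hchain m).trans (GridLoop.class_congr fun x => ?_))
  · rw [h₁]
    congr 1
    funext i
    simp [R]
  · change F (R m x) = _
    rw [h₂]
    -- The chain may stop at time `m`: where a coordinate of `Q x` reaches `m`, both values are
    -- `pt`; elsewhere the stage `R m x` equals `Q x`.
    by_cases h : ∃ i, m ≤ Q x i
    · obtain ⟨i, hi⟩ := h
      rw [hm _ i hi, hm (R m x) i (le_max_of_le_right (le_min hi le_rfl))]
    · push Not at h
      congr 1
      funext i
      have := hPQ x i
      have := h i
      simp only [R]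
      omega

/-! ### Concatenation of loops -/

variable [DecidableEq ι]

theorem Step.concat {i : ι} {p : ℕ} {F F' G G' : (ι → ℕ) → X} (hF : Step F F') (hG : Step G G')
    (hp : ∀ x, p ≤ x i → F x = pt) (hp' : ∀ x, p ≤ x i → F' x = pt)
    (h₀ : ∀ x, x i = 0 → G x = pt) (h₀' : ∀ x, x i = 0 → G' x = pt) :
    Step (concat i p F G) (concat i p F' G') := by
  intro x y h
  have hi := h i
  unfold SemiCoarse.concat
  split_ifs with hx hy hy
  · exact hF x y h
  -- Across the seam `x i = p` and `y i = p + 1`. There `F x` is `pt`, which is also the value of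
  -- `G` on its zero face, so the comparison takes place between `G` and `G'`.
  · rw [hp x (by omega), ← h₀ (Function.update x i 0) (by simp)]
    exact hG _ _ (h.update i (by omega) (by omega))
  · rw [hp' y (by omega), ← h₀' (Function.update y i 0) (by simp)]
    exact hG _ _ (h.update i (by omega) (by omega))
  · exact hG _ _ (h.update i (by omega) (by omega))

theorem IsGridLoop.concat {i : ι} (hi : i ∉ B) {p : ℕ} {F G : (ι → ℕ) → X}
    (hF : IsGridLoop A pt B F) (hG : IsGridLoop A pt B G) (hp : ∀ x, p ≤ x i → F x = pt) :
    IsGridLoop A pt B (concat i p F G) where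
  step := hF.step.concat hG.step hp hp (fun x => hG.zero x i hi) (fun x => hG.zero x i hi)
  zero x j hj h := by
    unfold SemiCoarse.concat
    split_ifs with hx
    · exact hF.zero x j hj h
    · have hji : j ≠ i := by rintro rfl; omega
      exact hG.zero _ j hj (by simpa [hji] using h)
  mem x j hj h := by
    unfold SemiCoarse.concat
    split_ifs with hx
    · exact hF.mem x j hj h
    · have hji : j ≠ i := by rintro rfl; omega
      exact hG.mem _ j hj (by simpa [hji] using h)
  bdd := by
    obtain ⟨m, hm⟩ := hF.bdd
    obtain ⟨k, hk⟩ := hG.bdd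
    refine ⟨p + m + k, fun x j hj => ?_⟩
    rcases eq_or_ne i j with rfl | hij
    · exact concat_eq_of_add_le hp (fun x => hk x i) x (by omega)
    · exact concat_eq_of_le hij (fun x h => hm x j (le_trans (by omega) h))
        (fun x h => hk x j (le_trans (by omega) h)) x hj

/-- Concatenation of grid loops. -/
def GridLoop.concat (i : ι) (hi : i ∉ B) (p : ℕ) (F G : GridLoop A pt B)
    (hp : ∀ x, p ≤ x i → F.1 x = pt) : GridLoop A pt B :=
  ⟨SemiCoarse.concat i p F.1 G.1, F.2.concat hi G.2 hp⟩

theorem GridLoop.class_concat_eq_of_le {i : ι} (hi : i ∉ B) {p q : ℕ} (hpq : p ≤ q)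
    (F G : GridLoop A pt B) (hp : ∀ x, p ≤ x i → F.1 x = pt) (hq : ∀ x, q ≤ x i → F.1 x = pt) :
    (F.concat i hi q G hq).class = (F.concat i hi p G hp).class := by
  obtain ⟨m, hm⟩ := (F.concat i hi p G hp).2.bdd
  -- Moving the seam from `p` to `q` amounts to pausing at `p` for `q - p` steps. This `P` lags
  -- behind the identity by at most `q - p`, which gives `M`.
  refine class_eq_of_reparam (F.concat i hi p G hp).2 hm (M := m + (q - p))
    (P := fun x => Function.update x i (max (min (x i) p) (x i - (q - p)))) (Q := id)
    ?_ ?_ (fun _ _ h => h) ?_ (fun _ _ _ h => h) ?_ (fun _ => rfl)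
  · intro x
    refine update_le_iff.2 ⟨?_, fun _ _ => le_rfl⟩
    simp
  · intro x y h
    have := h i
    exact h.update i (by omega) (by omega)
  · rintro x j (h | h)
    · left
      rcases eq_or_ne j i with rfl | hj
      · simp; omega
      · simp [hj]; omega
    · exact Or.inr h.symm
  · intro x
    simp only [GridLoop.concat, SemiCoarse.concat, Function.update_self, Function.update_idem]
    split_ifs with h₁ h₂ h₂
    · by_cases h : x i ≤ p
      · rw [min_eq_left h, max_eq_left (by omega), Function.update_eq_self]
      · rw [hp x (by omega), hp]
        simp; omega
    · omega
    · omega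
    · rw [show max (min (x i) p) (x i - (q - p)) - p = x i - q by omega]

theorem GridLoop.class_concat_eq {i : ι} (hi : i ∉ B) {p q : ℕ}
    (F G : GridLoop A pt B) (hp : ∀ x, p ≤ x i → F.1 x = pt) (hq : ∀ x, q ≤ x i → F.1 x = pt) :
    (F.concat i hi p G hp).class = (F.concat i hi q G hq).class := by
  rcases le_total p q with h | h
  · exact (class_concat_eq_of_le hi h F G hp hq).symm
  · exact class_concat_eq_of_le hi h F G hq hp

/-- Concatenation of classes of grid loops along the coordinate `i`. -/
noncomputable def LoopClasses.mul (i : ι) (hi : i ∉ B) :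
    LoopClasses A pt B → LoopClasses A pt B → LoopClasses A pt B :=
  Quot.lift₂ (fun F G => (F.concat i hi _ G (F.exists_bound i).choose_spec).class)
    (fun F G G' h => Quot.sound <| F.2.step.concat h (F.exists_bound i).choose_spec
      (F.exists_bound i).choose_spec (fun x => G.2.zero x i hi) (fun x => G'.2.zero x i hi))
    (fun F F' G h => by
      obtain ⟨p, hp⟩ := F.exists_bound i
      obtain ⟨q, hq⟩ := F'.exists_bound i
      -- The seams chosen for `F` and `F'` may differ, and `Step.concat` needs a common one.
      have hp' : ∀ x, max p q ≤ x i → F.1 x = pt := fun x hx => hp x (by omega)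
      have hq' : ∀ x, max p q ≤ x i → F'.1 x = pt := fun x hx => hq x (by omega)
      refine (F.class_concat_eq hi G _ hp').trans (Eq.trans (Quot.sound ?_)
        (F'.class_concat_eq hi G hq' _))
      exact h.concat G.2.step hp' hq' (fun x => G.2.zero x i hi) (fun x => G.2.zero x i hi))

/-- The constant grid loop. -/
def GridLoop.const (B : Set ι) (hpt : pt ∈ A) : GridLoop A pt B :=
  ⟨fun _ => pt, fun _ _ _ => Near.refl pt, fun _ _ _ _ => rfl, fun _ _ _ _ => hpt,
    0, fun _ _ _ => rfl⟩

/-! ### Group laws and commutativity for concatenation -/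

namespace LoopClasses

theorem mul_class {i : ι} (hi : i ∉ B) {p : ℕ} (F G : GridLoop A pt B)
    (hp : ∀ x, p ≤ x i → F.1 x = pt) :
    mul i hi F.class G.class = (F.concat i hi p G hp).class :=
  F.class_concat_eq hi G _ hp

/-- With the seam at `0` the product is pointwise the second loop, because that loop is `pt` on the
face `x i = 0`. -/
theorem const_mul (hpt : pt ∈ A) {i : ι} (hi : i ∉ B) (a : LoopClasses A pt B) :
    mul i hi (GridLoop.const B hpt).class a = a := by
  obtain ⟨F, rfl⟩ := Quot.exists_rep a
  refine (mul_class hi (p := 0) _ F fun _ _ => rfl).trans (GridLoop.class_congr fun x => ?_)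
  change (if x i ≤ 0 then pt else F.1 (Function.update x i (x i - 0))) = F.1 x
  split_ifs with h
  · exact (F.2.zero x i hi (by omega)).symm
  · simp

theorem mul_const (hpt : pt ∈ A) {i : ι} (hi : i ∉ B) (a : LoopClasses A pt B) :
    mul i hi a (GridLoop.const B hpt).class = a := by
  obtain ⟨F, rfl⟩ := Quot.exists_rep a
  obtain ⟨p, hp⟩ := F.exists_bound i
  refine (mul_class hi F _ hp).trans (GridLoop.class_congr fun x => ?_)
  change (if x i ≤ p then F.1 x else pt) = F.1 x
  split_ifs with h
  · rfl
  · exact (hp x (by omega)).symm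

/-- With seams `p`, `q` and `p + q` the two bracketings are the same function. -/
theorem mul_assoc {i : ι} (hi : i ∉ B) (a b c : LoopClasses A pt B) :
    mul i hi (mul i hi a b) c = mul i hi a (mul i hi b c) := by
  obtain ⟨F, rfl⟩ := Quot.exists_rep a
  obtain ⟨G, rfl⟩ := Quot.exists_rep b
  obtain ⟨K, rfl⟩ := Quot.exists_rep c
  obtain ⟨p, hp⟩ := F.exists_bound i
  obtain ⟨q, hq⟩ := G.exists_bound i
  change mul i hi (mul i hi F.class G.class) K.class =
    mul i hi F.class (mul i hi G.class K.class)
  rw [mul_class hi F G hp, mul_class hi G K hq, mul_class hi F _ hp,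
    mul_class hi (p := p + q) _ K (concat_eq_of_add_le hp hq)]
  refine GridLoop.class_congr fun x => ?_
  simp only [GridLoop.concat, concat, Function.update_self, Function.update_idem]
  split_ifs <;> first | rfl | omega | rw [Nat.sub_sub]

/-- The inverse is the reflection `x i ↦ m - x i`. Truncated subtraction sends everything beyond `m`
to the face `x i = 0`, where the loop is `pt`. -/
theorem exists_mul_eq_const (hpt : pt ∈ A) {i : ι} (hi : i ∉ B) (a : LoopClasses A pt B) :
    ∃ b, mul i hi b a = (GridLoop.const B hpt).class := by
  obtain ⟨F, rfl⟩ := Quot.exists_rep a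
  obtain ⟨m, hm⟩ := F.2.bdd
  have hupd : ∀ {x y : ι → ℕ}, Adj x y →
      Adj (Function.update x i (m - x i)) (Function.update y i (m - y i)) := fun h => by
    have := h i
    exact h.update i (by omega) (by omega)
  let G : GridLoop A pt B := ⟨fun x => F.1 (Function.update x i (m - x i)),
    { step := fun x y h => F.2.step _ _ (hupd h)
      zero := fun x j hj h => by
        rcases eq_or_ne j i with rfl | hji
        · exact hm _ j (by simp [h])
        · exact F.2.zero _ j hj (by simpa [hji] using h)
      mem := fun x j hj h => by
        have hji : j ≠ i := by rintro rfl; exact hi hj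
        exact F.2.mem _ j hj (by simpa [hji] using h)
      bdd := by
        refine ⟨m, fun x j h => ?_⟩
        rcases eq_or_ne j i with rfl | hji
        · exact F.2.zero _ j hi (by simp [h])
        · exact hm _ j (by simpa [hji] using h) }⟩
  have hG : ∀ x, m ≤ x i → G.1 x = pt := fun x h => F.2.zero _ i hi (by simp [h])
  refine ⟨G.class, (mul_class hi G F hG).trans ?_⟩
  -- The product is `F ∘ P` with `P` replacing `x i` by `|x i - m|`, written with truncated
  -- subtraction. Raising the coordinate to at least `m` makes `F ∘ Q` constantly `pt`. For `x i ≥ 2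
  -- * m`, and also for `x i = 0`, one has `|x i - m| ≥ m`.
  refine class_eq_of_reparam F.2 hm (M := 2 * m)
    (P := fun x => Function.update x i ((m - x i) + (x i - m)))
    (Q := fun x => Function.update x i (max m (x i))) ?_ ?_ ?_ ?_ ?_ ?_ ?_
  · intro x j
    rcases eq_or_ne j i with rfl | hji
    · simp; omega
    · simp [hji]
  · intro x y h
    have := h i
    exact h.update i (by omega) (by omega)
  · intro x y h
    have := h i
    exact h.update i (by omega) (by omega)
  · intro x j h
    rcases eq_or_ne j i with rfl | hji
    · left; simp; omega
    · rcases h with h | h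
      · left; simp [hji]; omega
      · right; simpa [hji] using h.symm
  · intro x j hj h
    have hji : j ≠ i := by rintro rfl; exact hi hj
    simpa [hji] using h
  · intro x
    simp only [GridLoop.concat, concat, G]
    split_ifs with h
    · rw [Nat.sub_eq_zero_of_le h, add_zero]
    · rw [Nat.sub_eq_zero_of_le (le_of_not_ge h), zero_add]
  · intro x
    exact (hm _ i (by simp)).symm

theorem mul_mul_mul_comm {i j : ι} (hi : i ∉ B) (hj : j ∉ B) (hij : i ≠ j)
    (a b c d : LoopClasses A pt B) :
    mul j hj (mul i hi a b) (mul i hi c d) =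
      mul i hi (mul j hj a c) (mul j hj b d) := by
  obtain ⟨F, rfl⟩ := Quot.exists_rep a
  obtain ⟨G, rfl⟩ := Quot.exists_rep b
  obtain ⟨H, rfl⟩ := Quot.exists_rep c
  obtain ⟨K, rfl⟩ := Quot.exists_rep d
  obtain ⟨m₁, h₁⟩ := F.2.bdd
  obtain ⟨m₂, h₂⟩ := G.2.bdd
  obtain ⟨m₃, h₃⟩ := H.2.bdd
  -- A single seam for all concatenations in both directions makes the two sides equal pointwise.
  -- `K` comes last in both directions, so its bound plays no role.
  have hF : ∀ l x, m₁ + m₂ + m₃ ≤ x l → F.1 x = pt := fun l x h => h₁ x l (by omega)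
  have hG : ∀ l x, m₁ + m₂ + m₃ ≤ x l → G.1 x = pt := fun l x h => h₂ x l (by omega)
  have hH : ∀ l x, m₁ + m₂ + m₃ ≤ x l → H.1 x = pt := fun l x h => h₃ x l (by omega)
  change mul j hj (mul i hi F.class G.class) (mul i hi H.class K.class) =
    mul i hi (mul j hj F.class H.class) (mul j hj G.class K.class)
  rw [mul_class hi F G (hF i), mul_class hi H K (hH i), mul_class hj F H (hF j),
    mul_class hj G K (hG j), mul_class hj _ _ (concat_eq_of_le hij (hF j) (hG j)),
    mul_class hi _ _ (concat_eq_of_le hij.symm (hF i) (hH i))]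
  refine GridLoop.class_congr fun x => ?_
  simp only [GridLoop.concat, concat, Function.update_of_ne hij, Function.update_of_ne hij.symm,
    Function.update_comm hij]
  split_ifs <;> rfl

/-- Concatenation along a coordinate outside `B` makes the classes of grid loops a group. -/
@[reducible]
noncomputable def group (hpt : pt ∈ A) (i : ι) (hi : i ∉ B) : Group (LoopClasses A pt B) :=
  letI : Mul (LoopClasses A pt B) := ⟨mul i hi⟩
  letI : One (LoopClasses A pt B) := ⟨(GridLoop.const B hpt).class⟩
  letI : Inv (LoopClasses A pt B) := ⟨fun a => (exists_mul_eq_const hpt hi a).choose⟩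
  Group.ofLeftAxioms (mul_assoc hi) (const_mul hpt hi)
    fun a => (exists_mul_eq_const hpt hi a).choose_spec

/-- Eckmann–Hilton: concatenations along `i` and along `j` share the constant loop as two-sided unit
and satisfy the interchange law. -/
theorem mul_comm (hpt : pt ∈ A) {i j : ι} (hi : i ∉ B) (hj : j ∉ B) (hij : i ≠ j)
    (a b : LoopClasses A pt B) : mul i hi a b = mul i hi b a :=
  (EckmannHilton.mul_comm (e₁ := (GridLoop.const B hpt).class) (e₂ := (GridLoop.const B hpt).class)
    ⟨{ left_id := const_mul hpt hj, right_id := mul_const hpt hj }⟩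
    ⟨{ left_id := const_mul hpt hi, right_id := mul_const hpt hi }⟩
    (mul_mul_mul_comm hi hj hij)).comm a b

end LoopClasses

end Grid

/-! ### Cube maps as grid loops -/

section Cube

variable {n m : ℕ}

theorem cube_controlled_iff {V : Set (Cube n m × Cube n m)} :
    V ∈ controlled (X := Cube n m) ↔ ∀ p ∈ V, ∀ i, |(p.1 i : ℤ) - p.2 i| ≤ 1 := by
  constructor
  · rintro ⟨U, hU, hV⟩ p hp i
    obtain ⟨W, hW, h⟩ := hU i
    have h₁ := hV hp i
    rw [h] at h₁
    exact hW h₁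
  · intro h
    exact ⟨fun i => Prod.map Subtype.val Subtype.val ⁻¹' {p : ℤ × ℤ | |p.1 - p.2| ≤ 1},
      fun i => ⟨_, fun _ h => h, rfl⟩, fun p hp i => h p hp i⟩

/-- The point of the cube with coordinates `min (x i) m`. -/
def clamp (m : ℕ) (x : Fin n → ℕ) : Cube n m :=
  fun i => ⟨min (x i : ℤ) m, le_min (Int.natCast_nonneg _) (Int.natCast_nonneg m), min_le_right _ _⟩

/-- The grid point underlying a point of the cube. -/
def coords (c : Cube n m) : Fin n → ℕ :=
  fun i => (c i : ℤ).toNat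

theorem natCast_coords (c : Cube n m) (i : Fin n) : (coords c i : ℤ) = c i :=
  Int.toNat_of_nonneg (c i).2.1

theorem clamp_coords {k : ℕ} (c : Cube n m) : clamp k (coords c) = retract k c := by
  funext i
  refine Subtype.ext ?_
  change min (coords c i : ℤ) k = min (c i : ℤ) k
  rw [natCast_coords]

theorem coords_clamp (x : Fin n → ℕ) (i : Fin n) : coords (clamp m x) i = min (x i) m := by
  have : (coords (clamp m x) i : ℤ) = min (x i : ℤ) m := natCast_coords _ _
  omega

theorem retract_clamp {k : ℕ} (h : m ≤ k) (x : Fin n → ℕ) : retract m (clamp k x) = clamp m x := by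
  funext i
  refine Subtype.ext ?_
  change min (min (x i : ℤ) k) m = min (x i : ℤ) m
  omega

theorem near_clamp {x y : Fin n → ℕ} (h : Adj x y) : Near (clamp m x) (clamp m y) := by
  refine cube_controlled_iff.2 ?_
  rintro _ rfl i
  have := h i
  change |min (x i : ℤ) m - min (y i : ℤ) m| ≤ 1
  rw [abs_le]
  omega

theorem adj_coords {V : Set (Cube n m × Cube n m)} (hV : V ∈ controlled (X := Cube n m))
    {p : Cube n m × Cube n m} (hp : p ∈ V) : Adj (coords p.1) (coords p.2) := by
  intro i
  have h := cube_controlled_iff.1 hV p hp i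
  rw [← natCast_coords, ← natCast_coords, abs_le] at h
  omega

/-- This form matches the faces on which a grid loop must be `pt`. The guard `0 < m` in the
definition of the box causes no exception: for `m = 0` a zero coordinate already equals `m`. -/
theorem mem_openBox_iff {x : Cube n m} :
    x ∈ openBox n m ↔ ∃ i : Fin n, (x i : ℤ) = m ∨ ((x i : ℤ) = 0 ∧ (i : ℕ) + 1 ≠ n) := by
  constructor
  · rintro ⟨⟨i, hi⟩, hb⟩
    by_cases hm : (x i : ℤ) = m
    · exact ⟨i, Or.inl hm⟩
    by_cases hl : (i : ℕ) + 1 = n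
    · obtain ⟨j, hji, hj⟩ := hb i hl (by have := (x i).2.2; omega) (by omega)
      refine ⟨j, hj.symm.imp id fun h => ⟨h, fun h' => hji (Fin.ext (by omega))⟩⟩
    · exact ⟨i, Or.inr ⟨by omega, hl⟩⟩
  · rintro ⟨i, hi⟩
    refine ⟨⟨i, by omega⟩, fun l hl hm h₀ => ⟨i, ?_, by omega⟩⟩
    rintro rfl
    omega

end Cube

/-- The faces that a map of triples may send to `A` rather than to `pt`: the last zero face, which
can be disregarded if `A = {pt}`. -/
def IsFreeFaces {X : Type*} {n : ℕ} (A : Set X) (pt : X) (B : Set (Fin n)) : Prop :=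
  (∀ i ∈ B, (i : ℕ) + 1 = n) ∧ ((∀ i : Fin n, (i : ℕ) + 1 = n → i ∈ B) ∨ A = {pt})

theorem isFreeFaces_empty {X : Type*} (n : ℕ) (pt : X) : IsFreeFaces {pt} pt (∅ : Set (Fin n)) :=
  ⟨fun _ h => h.elim, Or.inr rfl⟩

theorem isFreeFaces_last {X : Type*} (n : ℕ) (A : Set X) (pt : X) :
    IsFreeFaces A pt {i : Fin n | (i : ℕ) + 1 = n} :=
  ⟨fun _ h => h, Or.inl fun _ h => h⟩

/-! ### The homotopy sets as classes of grid loops -/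

section Bridge

variable {X : Type*} [SemiCoarseSpace X] {n : ℕ} {A : Set X} {pt : X} {B : Set (Fin n)}

/-- The extension of a cube map to the grid. -/
def CubeMap.toGrid {m : ℕ} (f : CubeMap n A pt m) : (Fin n → ℕ) → X :=
  fun x => f.toFun (clamp m x)

theorem CubeMap.toGrid_of_le {m : ℕ} (f : CubeMap n A pt m) (x : Fin n → ℕ) (i : Fin n)
    (h : m ≤ x i) : f.toGrid x = pt :=
  f.map_snd (mem_openBox_iff.2 ⟨i, Or.inl (min_eq_right (by exact_mod_cast h))⟩)

theorem CubeMap.isGridLoop (hB : IsFreeFaces A pt B) {m : ℕ} (f : CubeMap n A pt m) :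
    IsGridLoop A pt B f.toGrid where
  step _ _ h := f.bornologous.near (near_clamp h)
  zero x i hi h := by
    have h₀ : (clamp m x i : ℤ) = 0 := by
      change min (x i : ℤ) m = 0
      omega
    by_cases hl : (i : ℕ) + 1 = n
    -- The last zero face can lie outside `B` only if `A = {pt}`, and then landing in `A` suffices.
    · obtain hA | rfl := hB.2
      · exact absurd (hA i hl) hi
      · exact f.map_fst ⟨i, Or.inl h₀⟩
    · exact f.map_snd (mem_openBox_iff.2 ⟨i, Or.inr ⟨h₀, hl⟩⟩)
  mem x i _ h := f.map_fst ⟨i, Or.inl (by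
    change min (x i : ℤ) m = 0
    omega)⟩
  bdd := ⟨m, f.toGrid_of_le⟩

/-- A cube map as a grid loop. -/
def CubeMap.toGridLoop (hB : IsFreeFaces A pt B) {m : ℕ} (f : CubeMap n A pt m) :
    GridLoop A pt B :=
  ⟨f.toGrid, f.isGridLoop hB⟩

/-- The restriction of a grid loop to a large cube. -/
def GridLoop.toCubeMap (hpt : pt ∈ A) (hB : IsFreeFaces A pt B) (F : GridLoop A pt B) {m : ℕ}
    (hm : ∀ x i, m ≤ x i → F.1 x = pt) : CubeMap n A pt m where
  toFun c := F.1 (coords c)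
  bornologous := bornologous_of_finite_range (Set.finite_range _) fun _ hV _ hp =>
    F.2.step _ _ (adj_coords hV hp)
  map_fst := by
    rintro c ⟨i, hi⟩
    change F.1 (coords c) ∈ A
    have := natCast_coords c i
    by_cases h : m ≤ coords c i
    · rwa [hm _ i h]
    · by_cases hiB : i ∈ B
      · exact F.2.mem _ i hiB (by omega)
      · rwa [F.2.zero _ i hiB (by omega)]
  map_snd := by
    intro c hc
    obtain ⟨i, hi⟩ := mem_openBox_iff.1 hc
    have := natCast_coords c i
    rcases hi with hi | ⟨hi, hn⟩
    · exact hm _ i (by omega)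
    · exact F.2.zero _ i (fun h => hn (hB.1 i h)) (by omega)

theorem TripleMap.eq_of_toFun {Y Z : Type*} [SemiCoarseSpace Y] [SemiCoarseSpace Z]
    {A₁ B₁ : Set Y} {C D : Set Z} {f g : TripleMap A₁ B₁ C D}
    (h : ∀ x, f.toFun x = g.toFun x) : f = g := by
  cases f
  cases g
  simp only [TripleMap.mk.injEq]
  exact funext h

/-- Clamping at `m` loses nothing, since a point with a coordinate beyond `m` is clamped to one with
a coordinate `m`, and both values are `pt`. -/
theorem GridLoop.toGrid_toCubeMap (hpt : pt ∈ A) (hB : IsFreeFaces A pt B) (F : GridLoop A pt B)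
    {m : ℕ} (hm : ∀ x i, m ≤ x i → F.1 x = pt) (x : Fin n → ℕ) :
    (F.toCubeMap hpt hB hm).toGrid x = F.1 x := by
  change F.1 (coords (clamp m x)) = F.1 x
  by_cases h : ∃ i, m ≤ x i
  · obtain ⟨i, hi⟩ := h
    rw [hm x i hi, hm _ i (by rw [coords_clamp]; omega)]
  · push Not at h
    refine congrArg F.1 (funext fun i => ?_)
    rw [coords_clamp, min_eq_left (h i).le]

theorem GridLoop.toCubeMap_toGridLoop (hpt : pt ∈ A) (hB : IsFreeFaces A pt B) {m k : ℕ}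
    (h : m ≤ k) (f : CubeMap n A pt m) (hk : ∀ x i, k ≤ x i → (f.toGridLoop hB).1 x = pt) :
    (f.toGridLoop hB).toCubeMap hpt hB hk = CubeMap.extend h f :=
  TripleMap.eq_of_toFun fun c => congrArg f.toFun (clamp_coords c)

theorem CubeMap.toGrid_extend {m k : ℕ} (h : m ≤ k) (f : CubeMap n A pt m) (x : Fin n → ℕ) :
    (CubeMap.extend h f).toGrid x = f.toGrid x :=
  congrArg f.toFun (retract_clamp h x)

attribute [local instance] functionFunLike

theorem cls_extend {m k : ℕ} (h : m ≤ k) (f : CubeMap n A pt m) :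
    cls (CubeMap.extend h f) = cls f := by
  let a : CubeClasses n A pt m := Quotient.mk _ f
  exact (Quotient.sound (DirectLimit.r_of_le (transition n A pt) ⟨m, a⟩ k h)).symm

theorem cls_eq_of_homotopic {m : ℕ} {f g : CubeMap n A pt m} (h : f.Homotopic g) :
    cls f = cls g := by
  have : (Quotient.mk _ f : CubeClasses n A pt m) = Quotient.mk _ g := Quotient.sound h
  unfold cls
  rw [this]

/-- A single jump in time from `F` to `G` is already a homotopy: `Step` is exactly the nearness
needed across the jump. -/
theorem GridLoop.toCubeMap_homotopic (hpt : pt ∈ A) (hB : IsFreeFaces A pt B)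
    {F G : GridLoop A pt B} (h : Step F.1 G.1) {m : ℕ} (hF : ∀ x i, m ≤ x i → F.1 x = pt)
    (hG : ∀ x i, m ≤ x i → G.1 x = pt) :
    (F.toCubeMap hpt hB hF).Homotopic (G.toCubeMap hpt hB hG) := by
  refine ⟨fun p => if p.2 ≤ 0 then F.1 (coords p.1) else G.1 (coords p.1), ?_,
    ⟨0, 1, one_pos, fun x t ht => if_pos ht, fun x t ht => if_neg (by omega)⟩,
    fun x hx t => ?_, fun x hx t => ?_⟩
  · refine bornologous_of_finite_range
      (((Set.finite_range fun c : Cube n m => F.1 (coords c)).union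
        (Set.finite_range fun c : Cube n m => G.1 (coords c))).subset ?_) ?_
    · rintro _ ⟨p, rfl⟩
      dsimp only
      split_ifs
      · exact Or.inl ⟨_, rfl⟩
      · exact Or.inr ⟨_, rfl⟩
    · intro U hU p hp
      obtain ⟨V, hV, _, -, hVW⟩ := product_controlled_iff.1 hU
      have hadj : Adj (coords p.1.1) (coords p.2.1) := adj_coords hV (hVW hp).1
      split_ifs
      · exact F.2.step _ _ hadj
      · exact h _ _ hadj
      · exact (h _ _ fun i => (hadj i).symm).symm
      · exact G.2.step _ _ hadj
  · dsimp only
    split_ifs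
    · exact (F.toCubeMap hpt hB hF).map_fst hx
    · exact (G.toCubeMap hpt hB hG).map_fst hx
  · dsimp only
    split_ifs
    · exact (F.toCubeMap hpt hB hF).map_snd hx
    · exact (G.toCubeMap hpt hB hG).map_snd hx

/-- Both restrictions are compared on the cube of size `max m k`. The case `G = F` shows that the
class does not depend on the cube chosen. -/
theorem GridLoop.cls_toCubeMap_eq (hpt : pt ∈ A) (hB : IsFreeFaces A pt B)
    {F G : GridLoop A pt B} (h : Step F.1 G.1) {m k : ℕ} (hF : ∀ x i, m ≤ x i → F.1 x = pt)
    (hG : ∀ x i, k ≤ x i → G.1 x = pt) :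
    cls (F.toCubeMap hpt hB hF) = cls (G.toCubeMap hpt hB hG) := by
  have key : ∀ (F : GridLoop A pt B) {m k : ℕ} (hmk : m ≤ k) (hm : ∀ x i, m ≤ x i → F.1 x = pt)
      (hk : ∀ x i, k ≤ x i → F.1 x = pt),
      cls (F.toCubeMap hpt hB hm) = cls (F.toCubeMap hpt hB hk) := by
    intro F m k hmk hm hk
    rw [← cls_extend hmk]
    congr 1
    exact TripleMap.eq_of_toFun fun c =>
      (congrArg _ (clamp_coords c)).symm.trans (F.toGrid_toCubeMap hpt hB hm (coords c))
  rw [key F (le_max_left m k) hF fun x i hx => hF x i (by omega),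
    key G (le_max_right m k) hG fun x i hx => hG x i (by omega)]
  exact cls_eq_of_homotopic (toCubeMap_homotopic hpt hB h _ _)

/-- The slices of a homotopy at consecutive integer times from `M` to `N` form a chain of `Step`s.
-/
theorem CubeMap.class_eq_of_homotopic (hB : IsFreeFaces A pt B) {m : ℕ} {f g : CubeMap n A pt m}
    (h : f.Homotopic g) : (f.toGridLoop hB).class = (g.toGridLoop hB).class := by
  obtain ⟨H, hH, ⟨M, N, hMN, h₁, h₂⟩, hA, hpt⟩ := h
  have hnear : ∀ x y : Cube n m, Near x y → ∀ s t : ℤ, |s - t| ≤ 1 →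
      Near (H (x, s)) (H (y, t)) := by
    intro x y hxy s t hst
    refine hH.near (product_controlled_iff.2 ⟨_, hxy, {(s, t)}, ?_, ?_⟩)
    · rintro _ rfl
      exact hst
    · rintro _ rfl
      exact ⟨rfl, rfl⟩
  let L : ℤ → CubeMap n A pt m := fun t =>
    { toFun := fun x => H (x, t)
      bornologous := bornologous_of_finite_range (Set.finite_range _) fun V hV p hp =>
        hnear _ _ (subset_mem hV (by rintro _ rfl; exact hp)) t t (by simp)
      map_fst := fun x hx => hA x hx t
      map_snd := fun x hx => hpt x hx t }
  have hchain : ∀ k : ℕ, ((L M).toGridLoop hB).class = ((L (M + k)).toGridLoop hB).class := by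
    intro k
    induction k with
    | zero => simp
    | succ k ih =>
      refine ih.trans (Quot.sound fun x y hxy => hnear _ _ (near_clamp hxy) _ _ ?_)
      rw [abs_le]
      push_cast
      constructor <;> linarith
  have hf : L M = f := TripleMap.eq_of_toFun fun x => h₁ x M le_rfl
  have hg : L (M + (N - M).toNat) = g := TripleMap.eq_of_toFun fun x => h₂ x _ (by omega)
  rw [← hf, ← hg]
  exact hchain _

/-- The homotopy set is the set of grid loops up to homotopy. -/
noncomputable def homotopySetEquiv (hpt : pt ∈ A) (hB : IsFreeFaces A pt B) :
    RelHomotopySet n A pt ≃ LoopClasses A pt B where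
  toFun := DirectLimit.lift (transition n A pt)
    (fun m => Quotient.lift (fun f : CubeMap n A pt m => (f.toGridLoop hB).class)
      fun _ _ => CubeMap.class_eq_of_homotopic hB)
    (by
      rintro m k h ⟨f⟩
      exact (GridLoop.class_congr (CubeMap.toGrid_extend h f)).symm)
  invFun := Quot.lift (fun F => cls (F.toCubeMap hpt hB F.2.bdd.choose_spec))
    fun _ _ h => GridLoop.cls_toCubeMap_eq hpt hB h _ _
  left_inv := by
    rintro ⟨m, ⟨f⟩⟩
    -- The cube size picked by `bdd` need not be `m`, so the class is first moved back to size `m`.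
    exact (GridLoop.cls_toCubeMap_eq hpt hB (CubeMap.toGridLoop hB f).2.step _
      (CubeMap.toGrid_of_le f)).trans
      ((congrArg cls (GridLoop.toCubeMap_toGridLoop hpt hB le_rfl f _)).trans (cls_extend le_rfl f))
  right_inv := by
    rintro ⟨F⟩
    exact GridLoop.class_congr (F.toGrid_toCubeMap hpt hB F.2.bdd.choose_spec)

theorem homotopySetEquiv_cls (hpt : pt ∈ A) (hB : IsFreeFaces A pt B) {m : ℕ}
    (f : CubeMap n A pt m) : homotopySetEquiv hpt hB (cls f) = (f.toGridLoop hB).class :=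
  rfl

/-! ### The operation `⋆` as concatenation, and transport of the group structures -/

theorem star_eq_concat [NeZero n] {m k : ℕ} (f : CubeMap n A pt m) (g : CubeMap n A pt k)
    (c : Cube n (m + k)) :
    concat 0 m f.toGrid g.toGrid (coords c) = star f.toFun g.toFun c := by
  have h₀ := natCast_coords c 0
  unfold concat star CubeMap.toGrid
  split_ifs with h h' h'
  · omega
  · rw [clamp_coords]
  · rw [← clamp_coords]
    congr 2
    funext i
    have := natCast_coords c i
    have h₂ := natCast_coords (shiftFirst c h') i
    rw [show ((shiftFirst c h') i : ℤ) = if i = 0 then (c i : ℤ) - m else c i from rfl] at h₂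
    rcases eq_or_ne i 0 with rfl | hi
    · simp only [Function.update_self, ↓reduceIte] at *
      omega
    · simp only [Function.update_of_ne hi, if_neg hi] at *
      omega
  · omega

theorem isStarOperation_of_equiv [NeZero n] (hpt : pt ∈ A) (hB : IsFreeFaces A pt B)
    (h0 : (0 : Fin n) ∉ B) :
    IsStarOperation fun a b : RelHomotopySet n A pt => (homotopySetEquiv hpt hB).symm
      (LoopClasses.mul 0 h0 (homotopySetEquiv hpt hB a) (homotopySetEquiv hpt hB b)) := by
  intro m k f g
  have hF := fun x => f.toGrid_of_le x 0
  -- The seam must be exactly `m` to reproduce `f ⋆ g`; `mul_class` permits this choice.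
  let F := (f.toGridLoop hB).concat 0 h0 m (g.toGridLoop hB) hF
  have hb : ∀ x i, m + k ≤ x i → F.1 x = pt := by
    intro x i hx
    rcases eq_or_ne 0 i with rfl | hi
    · exact concat_eq_of_add_le hF (fun x => g.toGrid_of_le x 0) x hx
    · exact concat_eq_of_le hi (fun x h => f.toGrid_of_le x i (by omega))
        (fun x h => g.toGrid_of_le x i (by omega)) x hx
  refine ⟨F.toCubeMap hpt hB hb, funext (star_eq_concat f g), ?_⟩
  simp only [homotopySetEquiv_cls]
  rw [Equiv.symm_apply_eq, homotopySetEquiv_cls, LoopClasses.mul_class h0 _ _ hF]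
  exact (GridLoop.class_congr (F.toGrid_toCubeMap hpt hB hb)).symm

theorem exists_group_isStarOperation [NeZero n] (hpt : pt ∈ A) (hB : IsFreeFaces A pt B)
    (h0 : (0 : Fin n) ∉ B) :
    ∃ _ : Group (RelHomotopySet n A pt),
      IsStarOperation fun a b : RelHomotopySet n A pt => a * b :=
  letI := LoopClasses.group hpt 0 h0
  ⟨(homotopySetEquiv hpt hB).group, isStarOperation_of_equiv hpt hB h0⟩

theorem exists_commGroup_isStarOperation [NeZero n] (hpt : pt ∈ A) (hB : IsFreeFaces A pt B)
    (h0 : (0 : Fin n) ∉ B) {i : Fin n} (hi : i ∉ B) (hi0 : 0 ≠ i) :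
    ∃ _ : CommGroup (RelHomotopySet n A pt),
      IsStarOperation fun a b : RelHomotopySet n A pt => a * b :=
  letI : CommGroup (LoopClasses A pt B) :=
    { LoopClasses.group hpt 0 h0 with mul_comm := LoopClasses.mul_comm hpt h0 hi hi0 }
  ⟨(homotopySetEquiv hpt hB).commGroup, isStarOperation_of_equiv hpt hB h0⟩

end Bridge

end SemiCoarse

theorem mainTheorem1 {X : Type*} [SemiCoarseSpace X] (A : Set X) (pt : X) (hpt : pt ∈ A)
    (n : ℕ) [NeZero n] :
    (∃ _ : Group (SemiCoarse.HomotopySet n pt),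
      SemiCoarse.IsStarOperation (fun a b : SemiCoarse.HomotopySet n pt => a * b)) ∧
    (2 ≤ n → ∃ _ : CommGroup (SemiCoarse.HomotopySet n pt),
      SemiCoarse.IsStarOperation (fun a b : SemiCoarse.HomotopySet n pt => a * b)) ∧
    (2 ≤ n → ∃ _ : Group (SemiCoarse.RelHomotopySet n A pt),
      SemiCoarse.IsStarOperation (fun a b : SemiCoarse.RelHomotopySet n A pt => a * b)) ∧
    (3 ≤ n → ∃ _ : CommGroup (SemiCoarse.RelHomotopySet n A pt),
      SemiCoarse.IsStarOperation (fun a b : SemiCoarse.RelHomotopySet n A pt => a * b)) := by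
  have h0 : ((0 : Fin n) : ℕ) = 0 := rfl
  refine ⟨SemiCoarse.exists_group_isStarOperation rfl (SemiCoarse.isFreeFaces_empty n pt) (by simp),
    fun hn => ?_, fun hn => ?_, fun hn => ?_⟩
  -- In the absolute case no face is free, so coordinate `1` is a second direction as soon as `n ≥
  -- 2`.
  · exact SemiCoarse.exists_commGroup_isStarOperation rfl (SemiCoarse.isFreeFaces_empty n pt)
      (by simp) (i := ⟨1, hn⟩) (by simp) (fun h => by simp [Fin.ext_iff] at h)
  · refine SemiCoarse.exists_group_isStarOperation hpt (SemiCoarse.isFreeFaces_last n A pt) ?_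
    rw [Set.mem_ofPred_eq, h0]
    omega
  -- In the relative case the last coordinate is excluded, so coordinates `0` and `1` are both
  -- available only for `n ≥ 3`.
  · refine SemiCoarse.exists_commGroup_isStarOperation hpt (SemiCoarse.isFreeFaces_last n A pt) ?_
      (i := ⟨1, by omega⟩) ?_ (fun h => by simp [Fin.ext_iff] at h)
    · rw [Set.mem_ofPred_eq, h0]
      omega
    · change ¬1 + 1 = n
      omega
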